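/- Theorem (Blocked random phase states are designs). Let $\xi\ge 1$, $m\ge 2$, $k\ge 0$ and $n=m\xi$, and divide $n$ qubits, arranged on a line with free ends or on a ring, into $m$ consecutive patches of $\xi$ qubits each. For every pair $(a,a+1)$ of consecutive patches ($1\le a\le m-1$; on the ring also the pair $(m,1)$) let $f_{a,a+1}:\{0,1\}^{2\xi}\to\{0,1\}$ be a random function. Suppose that these random functions are mutually independent, and that each of them is $2k$-wise independent: for all distinct $z_1,\dots,z_{2k}\in\{0,1\}^{2\xi}$ and all $y_1,\dots,y_{2k}\in\{0,1\}$, $\Pr[f_{a,a+1}(z_i)=y_i \text{ for all } i]=2^{-2k}$. For $x\in\{0,1\}^n$ let $x_{a,a+1}\in\{0,1\}^{2\xi}$ be the string of the bits of $x$ on the patches $a$ and $a+1$. Consider the blocked random binary phase state $$|\psi\rangle=\frac1{\sqrt{2^n}}\sum_{x\in\{0,1\}^n}(-1)^{\sum_a f_{a,a+1}(x_{a,a+1})}\,|x\rangle .$$ Then $|\psi\rangle$ is an approximate state $k$-design up to additive error $$\varepsilon=\frac{3nk^2}{2^{\xi}\,\xi}+\frac{2k^2}{2^n},$$ that is, for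 every unit vector $|\varphi\rangle\in(\mathbb C^2)^{\otimes n}$, $$\Big\|\,\mathbb E_{\psi}\big(|\psi\rangle\langle\psi|\big)^{\otimes k}-\mathbb E_{U}\,U^{\otimes k}\big(|\varphi\rangle\langle\varphi|\big)^{\otimes k}(U^\dagger)^{\otimes k}\Big\|_1\le\varepsilon ,$$ where $U$ is a Haar-random unitary on the $n$ qubits and $\|A\|_1=\operatorname{tr}\sqrt{A^\dagger A}$ is the trace norm. Moreover $\varepsilon\le 4nk^2/(2^{\xi}\xi)$, so that $\varepsilon=\mathcal O\big(nk^2/(2^{\xi}\xi)\big)$ with an absolute implied constant. -/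

import Mathlib

open MeasureTheory ProbabilityTheory

noncomputable section

/-- Bit strings of length `n`; they label the computational basis of `n` qubits. -/
abbrev Bits (n : ℕ) : Type := Fin n → Bool

/-- The trace norm `‖A‖₁ = tr √(Aᴴ A)`: the sum of the singular values of `A`. -/
def traceNorm {κ : Type*} [Fintype κ] [DecidableEq κ] (A : Matrix κ κ ℂ) : ℝ :=
  ∑ i, Real.sqrt ((Matrix.isHermitian_conjTranspose_mul_self A).eigenvalues i)

/-- The amplitudes of `|ψ⟩^{⊗ k}` in the product basis, which is labelled by lists
`x = (x 0, …, x (k - 1))` of basis labels. -/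
def tensorCopies {ι : Type*} (k : ℕ) (ψ : EuclideanSpace ℂ ι) : (Fin k → ι) → ℂ :=
  fun x => ∏ j, ψ (x j)

/-- The `k`-th moment `𝔼 (|ψ⟩⟨ψ|)^{⊗ k}` of a random state `ψ`, as a matrix in the product
basis (the expectation is taken entry by entry). -/
def stateMoment {ι Ω : Type*} [MeasurableSpace Ω] (k : ℕ) (μ : Measure Ω)
    (ψ : Ω → EuclideanSpace ℂ ι) : Matrix (Fin k → ι) (Fin k → ι) ℂ :=
  Matrix.of fun x y =>
    ∫ ω, Matrix.vecMulVec (tensorCopies k (ψ ω)) (star (tensorCopies k (ψ ω))) x y ∂μ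

section Haar

variable (ι : Type*) [Fintype ι] [DecidableEq ι]

instance unitaryGroupCompactSpace : CompactSpace (Matrix.unitaryGroup ι ℂ) := by
  refine (isCompact_iff_compactSpace
    (s := (Matrix.unitaryGroup ι ℂ : Set (Matrix ι ι ℂ)))).mp ?_
  have hK : IsCompact (Set.univ.pi fun _ : ι => Set.univ.pi fun _ : ι =>
      Metric.closedBall (0 : ℂ) 1) :=
    isCompact_univ_pi fun _ => isCompact_univ_pi fun _ => isCompact_closedBall _ _
  refine IsCompact.of_isClosed_subset hK (isClosed_unitary (R := Matrix ι ι ℂ)) ?_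
  intro U hU i _ j _
  simpa using entry_norm_bound_of_unitary (𝕜 := ℂ) hU i j

instance unitaryGroupMeasurableSpace : MeasurableSpace (Matrix.unitaryGroup ι ℂ) := borel _

instance unitaryGroupBorelSpace : BorelSpace (Matrix.unitaryGroup ι ℂ) := ⟨rfl⟩

/-- The Haar probability measure on the (compact) unitary group: the Haar measure that gives
the whole group mass one. -/
def haarUnitary : Measure (Matrix.unitaryGroup ι ℂ) := Measure.haarMeasure ⊤

end Haar

/-- The Haar twirl `𝔼_U U^{⊗ k} (|φ⟩⟨φ|)^{⊗ k} (Uᴴ)^{⊗ k}` of `k` copies of `φ`. -/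
def haarTwirl {ι : Type*} [Fintype ι] [DecidableEq ι] (k : ℕ) (φ : EuclideanSpace ℂ ι) :
    Matrix (Fin k → ι) (Fin k → ι) ℂ :=
  stateMoment k (haarUnitary ι) fun U => WithLp.toLp 2 ((U : Matrix ι ι ℂ).mulVec φ.ofLp)

/-- A random `n`-qubit state `ψ` is a state `k`-design up to additive error `ε`: its `k`-th
moment is `ε`-close, in trace norm, to the Haar twirl of `k` copies of any pure state. -/
def IsApproxStateDesign {n : ℕ} {Ω : Type*} [MeasurableSpace Ω] (k : ℕ) (μ : Measure Ω)
    (ψ : Ω → EuclideanSpace ℂ (Bits n)) (ε : ℝ) : Prop :=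
  ∀ φ : EuclideanSpace ℂ (Bits n), ‖φ‖ = 1 →
    traceNorm (stateMoment k μ ψ - haarTwirl k φ) ≤ ε

/-- A random binary function `f` is `t`-wise independent: at any `t` distinct inputs its values
are independent uniform bits. -/
def IsTWiseIndependent {Ω α : Type*} [MeasurableSpace Ω] (t : ℕ) (μ : Measure Ω)
    (f : Ω → α → Bool) : Prop :=
  ∀ x : Fin t → α, Function.Injective x → ∀ y : Fin t → Bool,
    μ.real {ω | ∀ i, f ω (x i) = y i} = (1 / 2 : ℝ) ^ t

/-- How the patches are arranged on a line: with free ends, or closed up to a ring. -/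
inductive Boundary where
  | free
  | periodic
  deriving DecidableEq

/-- Patch `c` comes directly after patch `a`, for `m` patches numbered `0, …, m - 1`. -/
def IsNextPatch (b : Boundary) {m : ℕ} (a c : Fin m) : Prop :=
  a.val + 1 = c.val ∨ (b = Boundary.periodic ∧ a.val + 1 = m ∧ c.val = 0)

instance (b : Boundary) {m : ℕ} (a c : Fin m) : Decidable (IsNextPatch b a c) :=
  inferInstanceAs (Decidable (_ ∨ _))

/-- The blocks of the brickwork: one for each pair of consecutive patches. The blocks whose first
patch has even number form one layer, the other ones the second layer; as all phase gates
commute, the order in which they are applied is immaterial. -/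
abbrev Block (b : Boundary) (m : ℕ) : Type :=
  {p : Fin m × Fin m // IsNextPatch b p.1 p.2}

/-- The `ξ` bits of `x` on patch `a`, that is, those at the positions `a ξ, …, a ξ + ξ - 1`. -/
def patchBits {n m ξ : ℕ} (hn : n = m * ξ) (x : Bits n) (a : Fin m) : Bits ξ :=
  fun i => x (Fin.cast hn.symm (finProdFinEquiv (a, i)))

/-- The `2 ξ` bits of `x` on the two patches of a block. -/
def blockBits {n m ξ : ℕ} (hn : n = m * ξ) {b : Boundary} (x : Bits n) (p : Block b m) :
    Bits (ξ + ξ) :=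
  Fin.append (patchBits hn x p.1.1) (patchBits hn x p.1.2)

/-- The blocked binary phase state
`2^{-n/2} ∑_x (-1)^{∑_p f_p(x_p)} |x⟩`, where `p` runs over the blocks. -/
def blockedPhaseState {n m ξ : ℕ} (hn : n = m * ξ) (b : Boundary)
    (f : Block b m → Bits (ξ + ξ) → Bool) : EuclideanSpace ℂ (Bits n) :=
  WithLp.toLp 2 fun x =>
    (1 / (Real.sqrt (2 ^ n) : ℂ)) * (-1) ^ ∑ p, (f p (blockBits hn x p)).toNat

end

/-!
Call a tuple `x` of `k` bit strings good if its entries differ pairwise on every patch. If `x` is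
good, then the phases make the entry `(x, y)` of the moment of `|ψ⟩` vanish unless `y` agrees with
`x` on every block up to a permutation of the entries; as consecutive patches share a block and
the entries of `x` are told apart by each single patch, these permutations all coincide. On the
good rows the moment is therefore `2 ^ (-n k)` on the permutations of `x` and zero elsewhere. The
Haar twirl has the same shape on the tuples with distinct entries, by invariance under sign flips
and permutations of the basis vectors, so both moments dominate a common positive semidefinite
block, and the trace norm of their difference is bounded by the weight outside it. A union bound
over the pairs of copies, applied to collisions on a patch for `|ψ⟩` and to collisions of basis
vectors for the Haar state, estimates this weight.
-/

section TraceNorm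

open Matrix
open scoped ComplexOrder

variable {κ : Type*} [Fintype κ] [DecidableEq κ]

theorem traceNorm_eq_sum_abs_eigenvalues {A : Matrix κ κ ℂ} (hA : A.IsHermitian) :
    traceNorm A = ∑ i, |hA.eigenvalues i| := by
  have hB := isHermitian_conjTranspose_mul_self A
  have hsq : cfc (fun t : ℝ => t ^ 2) A = Aᴴ * A := by
    rw [hA.eq, ← sq]
    exact cfc_pow_id A 2 hA
  have hchar : (Aᴴ * A).charpoly =
      ∏ i, (Polynomial.X - Polynomial.C ((hA.eigenvalues i ^ 2 : ℝ) : ℂ)) :=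
    hsq ▸ hA.charpoly_cfc_eq _
  have hroots : (Finset.univ.val.map fun i => (hB.eigenvalues i : ℂ)) =
      Finset.univ.val.map fun i => ((hA.eigenvalues i ^ 2 : ℝ) : ℂ) := by
    refine hB.roots_charpoly_eq_eigenvalues.symm.trans ?_
    rw [hchar, ← Polynomial.roots_multiset_prod_X_sub_C (Finset.univ.val.map _), Multiset.map_map]
    rfl
  have hsum := congrArg (fun s : Multiset ℂ => (s.map fun z => √z.re).sum) hroots
  simp only [Multiset.map_map, Function.comp_def, Complex.ofReal_re, Real.sqrt_sq_eq_abs] at hsum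
  exact hsum

theorem sum_eigenvectorBasis_dotProduct_mulVec {A : Matrix κ κ ℂ} (hA : A.IsHermitian)
    (P : Matrix κ κ ℂ) :
    ∑ i, star (hA.eigenvectorBasis i).ofLp ⬝ᵥ P *ᵥ (hA.eigenvectorBasis i).ofLp = P.trace := by
  have htrace : LinearMap.trace ℂ _ (toEuclideanLin P) = P.trace := by
    rw [toEuclideanLin_eq_toLin_orthonormal, trace_toLin_eq]
  rw [← htrace, LinearMap.trace_eq_sum_inner _ hA.eigenvectorBasis]
  exact Finset.sum_congr rfl fun i _ => dotProduct_comm _ _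

theorem traceNorm_sub_le_trace_add_trace {P R : Matrix κ κ ℂ} (hP : P.PosSemidef)
    (hR : R.PosSemidef) : traceNorm (P - R) ≤ P.trace.re + R.trace.re := by
  have hPR : (P - R).IsHermitian := hP.1.sub hR.1
  rw [traceNorm_eq_sum_abs_eigenvalues hPR, ← sum_eigenvectorBasis_dotProduct_mulVec hPR P,
    ← sum_eigenvectorBasis_dotProduct_mulVec hPR R, Complex.re_sum, Complex.re_sum,
    ← Finset.sum_add_distrib]
  refine Finset.sum_le_sum fun i _ => ?_
  have hP0 := hP.re_dotProduct_nonneg (hPR.eigenvectorBasis i).ofLp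
  have hR0 := hR.re_dotProduct_nonneg (hPR.eigenvectorBasis i).ofLp
  rw [hPR.eigenvalues_eq i, sub_mulVec, dotProduct_sub, map_sub]
  exact (abs_sub _ _).trans_eq (by rw [abs_of_nonneg hP0, abs_of_nonneg hR0]; rfl)

theorem traceNorm_sub_le_of_common_part {P R S : Matrix κ κ ℂ} (hP : (P - S).PosSemidef)
    (hR : (R - S).PosSemidef) :
    traceNorm (P - R) ≤ P.trace.re + R.trace.re - 2 * S.trace.re := by
  have h := traceNorm_sub_le_trace_add_trace hP hR
  rw [sub_sub_sub_cancel_right, trace_sub, trace_sub, Complex.sub_re, Complex.sub_re] at h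
  linarith

/-- The compression `Π A Π` of a matrix by the projection `Π` onto the span of the basis vectors
with labels in `G`. -/
def compression (G : Finset κ) (A : Matrix κ κ ℂ) : Matrix κ κ ℂ :=
  diagonal (fun x => if x ∈ G then 1 else 0) * A * diagonal fun x => if x ∈ G then 1 else 0

theorem compression_apply (G : Finset κ) (A : Matrix κ κ ℂ) (x y : κ) :
    compression G A x y = if x ∈ G ∧ y ∈ G then A x y else 0 := by
  by_cases hx : x ∈ G <;> by_cases hy : y ∈ G <;> simp [compression, hx, hy]

theorem posSemidef_compression {A : Matrix κ κ ℂ} (hA : A.PosSemidef) (G : Finset κ) :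
    (compression G A).PosSemidef := by
  have hG : (diagonal fun x => if x ∈ G then (1 : ℂ) else 0).IsHermitian :=
    isHermitian_diagonal_of_self_adjoint _ (funext fun x => by by_cases hx : x ∈ G <;> simp [hx])
  simpa only [compression, hG.eq] using
    hA.mul_mul_conjTranspose_same (diagonal fun x => if x ∈ G then 1 else 0)

theorem trace_compression (G : Finset κ) (A : Matrix κ κ ℂ) :
    (compression G A).trace = ∑ x ∈ G, A x x := by
  simp [trace, compression_apply]

theorem posSemidef_sub_smul_compression {A M : Matrix κ κ ℂ} (hA : A.PosSemidef)
    (hM : M.PosSemidef) {G : Finset κ} {r s : ℝ} (hsr : s ≤ r)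
    (hMA : ∀ x ∈ G, ∀ y, M x y = r * A x y) (hAG : ∀ x ∈ G, ∀ y ∉ G, A x y = 0) :
    (M - (s : ℂ) • compression G A).PosSemidef := by
  have hMG : ∀ x ∈ G, ∀ y ∉ G, M x y = 0 := fun x hx y hy => by
    rw [hMA x hx, hAG x hx y hy, mul_zero]
  have hMG' : ∀ x ∉ G, ∀ y ∈ G, M x y = 0 := fun x hx y hy => by
    rw [← hM.1.apply, hMG y hy x hx, star_zero]
  have hsplit : M - (s : ℂ) • compression G A =
      ((r - s : ℝ) : ℂ) • compression G A + compression Gᶜ M := by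
    ext x y
    by_cases hx : x ∈ G <;> by_cases hy : y ∈ G <;>
      simp [compression_apply, hx, hy, hMA, hAG, hMG', sub_mul]
  rw [hsplit]
  exact ((posSemidef_compression hA G).smul (Complex.zero_le_real.mpr (sub_nonneg.mpr hsr))).add
    (posSemidef_compression hM Gᶜ)

theorem traceNorm_sub_le_of_block {A H : Matrix κ κ ℂ} (hA : A.PosSemidef) (hH : H.PosSemidef)
    (hA_trace : A.trace = 1) (hH_trace : H.trace = 1) {G : Finset κ} {r s : ℝ} (hs : s ≤ 1)
    (hsr : s ≤ r) (hHA : ∀ x ∈ G, ∀ y, H x y = r * A x y) (hAG : ∀ x ∈ G, ∀ y ∉ G, A x y = 0) :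
    traceNorm (A - H) ≤ 2 * (1 - s * ∑ x ∈ G, (A x x).re) := by
  -- `A` and `H` both dominate `s • compression G A`.
  have h := traceNorm_sub_le_of_common_part
    (posSemidef_sub_smul_compression hA hA hs (fun x _ y => by simp) hAG)
    (posSemidef_sub_smul_compression hA hH hsr hHA hAG)
  rw [hA_trace, hH_trace, trace_smul, trace_compression, smul_eq_mul, Complex.re_ofReal_mul,
    Complex.re_sum, Complex.one_re] at h
  linarith

end TraceNorm

section RandomState

variable {ι Ω β : Type*} [MeasurableSpace Ω] {k : ℕ} {μ : Measure Ω}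
  {ψ : Ω → EuclideanSpace ℂ ι}

/-- A random pure state: a random unit vector with measurable dependence on the sample point. -/
structure IsRandomState [Fintype ι] (ψ : Ω → EuclideanSpace ℂ ι) : Prop where
  measurable : Measurable ψ
  norm_eq_one : ∀ ω, ‖ψ ω‖ = 1

/-- The probability of the outcomes `x 0, …, x (k - 1)` when `k` copies of the random state `ψ`
are measured in the computational basis. -/
noncomputable def outcomeProb (k : ℕ) (μ : Measure Ω) (ψ : Ω → EuclideanSpace ℂ ι)
    (x : Fin k → ι) : ℝ :=
  ∫ ω, ∏ j, ‖ψ ω (x j)‖ ^ 2 ∂μ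

/-- The probability that `g` takes the same value at the outcomes of measurements of two copies
of the random state `ψ`. -/
noncomputable def collisionProb [Fintype ι] [Fintype β] [DecidableEq β] (g : ι → β) (μ : Measure Ω)
    (ψ : Ω → EuclideanSpace ℂ ι) : ℝ :=
  ∫ ω, ∑ b, (∑ z with g z = b, ‖ψ ω z‖ ^ 2) ^ 2 ∂μ

theorem tensorCopies_comp_perm (φ : EuclideanSpace ℂ ι) (x : Fin k → ι)
    (σ : Equiv.Perm (Fin k)) : tensorCopies k φ (x ∘ σ) = tensorCopies k φ x :=
  Equiv.prod_comp σ fun j => φ (x j)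

theorem tensorCopies_mul_star_self (φ : EuclideanSpace ℂ ι) (x : Fin k → ι) :
    tensorCopies k φ x * star (tensorCopies k φ x) = (∏ j, ‖φ (x j)‖ ^ 2 : ℝ) := by
  rw [tensorCopies, Complex.star_def, Complex.mul_conj', norm_prod, ← Complex.ofReal_pow,
    Finset.prod_pow]

theorem stateMoment_apply (x y : Fin k → ι) :
    stateMoment k μ ψ x y =
      ∫ ω, tensorCopies k (ψ ω) x * star (tensorCopies k (ψ ω) y) ∂μ := rfl

theorem stateMoment_apply_comp_perm (x : Fin k → ι) (σ : Equiv.Perm (Fin k)) :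
    stateMoment k μ ψ x (x ∘ σ) = stateMoment k μ ψ x x := by
  simp_rw [stateMoment_apply, tensorCopies_comp_perm]

theorem stateMoment_apply_self (x : Fin k → ι) :
    stateMoment k μ ψ x x = outcomeProb k μ ψ x := by
  simp_rw [stateMoment_apply, tensorCopies_mul_star_self]
  exact integral_complex_ofReal

theorem collisionProb_of_norm_sq_eq [Fintype ι] [Fintype β] [DecidableEq β]
    [IsProbabilityMeasure μ] {c : ℝ} (hflat : ∀ ω z, ‖ψ ω z‖ ^ 2 = c) (g : ι → β) :
    collisionProb g μ ψ = ∑ b, ((Finset.univ.filter (g · = b)).card * c) ^ 2 := by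
  simp [collisionProb, hflat]

theorem outcomeProb_nonneg (x : Fin k → ι) : 0 ≤ outcomeProb k μ ψ x :=
  integral_nonneg fun _ => Finset.prod_nonneg fun _ _ => sq_nonneg _

theorem outcomeProb_of_norm_sq_eq [IsProbabilityMeasure μ] {c : ℝ}
    (hflat : ∀ ω z, ‖ψ ω z‖ ^ 2 = c) (x : Fin k → ι) : outcomeProb k μ ψ x = c ^ k := by
  simp [outcomeProb, hflat]

theorem collisionProb_nonneg [Fintype ι] [Fintype β] [DecidableEq β] (g : ι → β) :
    0 ≤ collisionProb g μ ψ :=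
  integral_nonneg fun _ => Finset.sum_nonneg fun _ _ => sq_nonneg _

open scoped ComplexOrder in
theorem posSemidef_of_integral {κ : Type*} [Finite κ] {F : Ω → Matrix κ κ ℂ}
    (hF_int : ∀ x y, Integrable (fun ω => F ω x y) μ) (hF : ∀ ω, (F ω).PosSemidef) :
    (Matrix.of fun x y => ∫ ω, F ω x y ∂μ).PosSemidef := by
  have := Fintype.ofFinite κ
  refine .of_dotProduct_mulVec_nonneg ?_ fun v => ?_
  · ext x y
    simp only [Matrix.conjTranspose_apply, Matrix.of_apply, Complex.star_def, ← integral_conj]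
    exact integral_congr_ae (.of_forall fun ω => (hF ω).1.apply x y)
  · have hquad : star v ⬝ᵥ (Matrix.of fun x y => ∫ ω, F ω x y ∂μ).mulVec v =
        ∫ ω, star v ⬝ᵥ (F ω).mulVec v ∂μ := by
      simp only [dotProduct, Matrix.mulVec, Matrix.of_apply]
      rw [integral_finsetSum _ fun x _ =>
        (integrable_finsetSum _ fun y _ => (hF_int x y).mul_const _).const_mul _]
      refine Finset.sum_congr rfl fun x _ => ?_
      rw [integral_const_mul, integral_finsetSum _ fun y _ => (hF_int x y).mul_const _]
      simp only [integral_mul_const]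
    rw [hquad]
    exact integral_nonneg fun ω => (hF ω).dotProduct_mulVec_nonneg v

theorem sum_prod_filter_eq {κ : Type*} [Fintype κ] [DecidableEq κ] [Fintype ι] [Fintype β]
    [DecidableEq β] (g : ι → β) {p : ι → ℝ} (hp : ∑ z, p z = 1) {i j : κ} (hij : i ≠ j) :
    ∑ x : κ → ι with g (x i) = g (x j), ∏ l, p (x l) = ∑ b, (∑ z with g z = b, p z) ^ 2 := by
  rw [← Finset.sum_fiberwise _ fun x => g (x i)]
  refine Finset.sum_congr rfl fun b _ => ?_
  let S : κ → Finset ι := fun l =>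
    if l ∈ ({i, j} : Finset κ) then Finset.univ.filter (g · = b) else Finset.univ
  have hS : ({x ∈ ({x | g (x i) = g (x j)} : Finset (κ → ι)) | g (x i) = b} : Finset (κ → ι)) =
      Fintype.piFinset S := by
    ext x
    simp only [Finset.mem_filter, Finset.mem_univ, true_and, Fintype.mem_piFinset]
    refine ⟨fun ⟨hj, hi⟩ l => ?_, fun h => ?_⟩
    · by_cases hl : l = i ∨ l = j
      · rcases hl with rfl | rfl <;> simp [S, hi, ← hj]
      · simp [S, hl]
    · have hi : g (x i) = b := by simpa [S] using h i
      have hj : g (x j) = b := by simpa [S] using h j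
      exact ⟨hi.trans hj.symm, hi⟩
  have hsum : ∀ l, ∑ z ∈ S l, p z =
      if l ∈ ({i, j} : Finset κ) then ∑ z with g z = b, p z else 1 := fun l => by
    by_cases hl : l ∈ ({i, j} : Finset κ) <;> simp only [S, hl, if_true, if_false, hp]
  rw [hS, ← Finset.prod_univ_sum S fun _ => p, Finset.prod_congr rfl fun l _ => hsum l,
    Finset.prod_ite_mem, Finset.univ_inter, Finset.prod_const, Finset.card_pair hij]

theorem sum_filter_exists_le {κ τ : Type*} [Fintype κ] {w : κ → ℝ} (hw : ∀ x, 0 ≤ w x)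
    (T : Finset τ) (q : τ → κ → Prop) [∀ p, DecidablePred (q p)]
    [DecidablePred fun x => ∃ p ∈ T, q p x] :
    ∑ x with ∃ p ∈ T, q p x, w x ≤ ∑ p ∈ T, ∑ x with q p x, w x := by
  simp only [Finset.sum_filter]
  rw [Finset.sum_comm]
  refine Finset.sum_le_sum fun x _ => ?_
  have hterm : ∀ p ∈ T, 0 ≤ if q p x then w x else 0 := fun p _ => by
    split_ifs
    exacts [hw x, le_rfl]
  split_ifs with hx
  · obtain ⟨p, hp, hq⟩ := hx
    simpa only [if_pos hq] using Finset.single_le_sum hterm hp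
  · exact Finset.sum_nonneg hterm

section

variable [Fintype ι]

namespace IsRandomState

theorem norm_apply_le_one (hψ : IsRandomState ψ) (ω : Ω) (z : ι) : ‖ψ ω z‖ ≤ 1 :=
  (PiLp.norm_apply_le (ψ ω) z).trans_eq (hψ.norm_eq_one ω)

theorem sum_norm_sq (hψ : IsRandomState ψ) (ω : Ω) : ∑ z, ‖ψ ω z‖ ^ 2 = 1 := by
  rw [← EuclideanSpace.norm_sq_eq, hψ.norm_eq_one, one_pow]

theorem integrable_tensorCopies_mul_star [IsFiniteMeasure μ] (hψ : IsRandomState ψ)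
    (x y : Fin k → ι) :
    Integrable (fun ω => tensorCopies k (ψ ω) x * star (tensorCopies k (ψ ω) y)) μ := by
  have hbound : ∀ ω (x : Fin k → ι), ‖tensorCopies k (ψ ω) x‖ ≤ 1 := fun ω x => by
    rw [tensorCopies, norm_prod]
    exact Finset.prod_le_one (fun _ _ => norm_nonneg _) fun j _ => hψ.norm_apply_le_one ω (x j)
  have hmeas : ∀ x : Fin k → ι, Measurable fun ω => tensorCopies k (ψ ω) x := fun x => by
    have := hψ.measurable
    unfold tensorCopies
    fun_prop
  have hmeas_mul := (hmeas x).mul (continuous_star.measurable.comp (hmeas y))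
  refine .of_bound hmeas_mul.aestronglyMeasurable 1 (.of_forall fun ω => ?_)
  rw [norm_mul, norm_star]
  exact mul_le_one₀ (hbound ω x) (norm_nonneg _) (hbound ω y)

theorem integrable_prod_norm_sq [IsFiniteMeasure μ] (hψ : IsRandomState ψ) (x : Fin k → ι) :
    Integrable (fun ω => ∏ j, ‖ψ ω (x j)‖ ^ 2) μ := by
  simpa only [tensorCopies_mul_star_self, RCLike.re_eq_complex_re, Complex.ofReal_re] using
    (hψ.integrable_tensorCopies_mul_star x x).re

open scoped ComplexOrder in
theorem posSemidef_stateMoment [IsFiniteMeasure μ] (hψ : IsRandomState ψ) :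
    (stateMoment k μ ψ).PosSemidef :=
  posSemidef_of_integral hψ.integrable_tensorCopies_mul_star
    fun _ => Matrix.posSemidef_vecMulVec_self_star _

theorem sum_outcomeProb [IsProbabilityMeasure μ] (hψ : IsRandomState ψ) :
    ∑ x, outcomeProb k μ ψ x = 1 := by
  have hsum : ∀ ω, ∑ x : Fin k → ι, ∏ j, ‖ψ ω (x j)‖ ^ 2 = 1 := fun ω => by
    rw [← Fintype.sum_pow fun z => ‖ψ ω z‖ ^ 2, hψ.sum_norm_sq, one_pow]
  simp only [outcomeProb]
  rw [← integral_finsetSum _ fun x _ => hψ.integrable_prod_norm_sq x]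
  simp [hsum]

theorem sum_outcomeProb_le_one [IsProbabilityMeasure μ] (hψ : IsRandomState ψ)
    (G : Finset (Fin k → ι)) : ∑ x ∈ G, outcomeProb k μ ψ x ≤ 1 :=
  (Finset.sum_le_univ_sum_of_nonneg outcomeProb_nonneg).trans_eq hψ.sum_outcomeProb

theorem trace_stateMoment [IsProbabilityMeasure μ] (hψ : IsRandomState ψ) :
    (stateMoment k μ ψ).trace = 1 := by
  simp only [Matrix.trace, Matrix.diag_apply, stateMoment_apply_self]
  rw [← Complex.ofReal_sum, hψ.sum_outcomeProb, Complex.ofReal_one]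

theorem sum_outcomeProb_filter_eq [IsFiniteMeasure μ] [Fintype β] [DecidableEq β]
    (hψ : IsRandomState ψ) (g : ι → β) {i j : Fin k} (hij : i ≠ j) :
    ∑ x with g (x i) = g (x j), outcomeProb k μ ψ x = collisionProb g μ ψ := by
  simp only [outcomeProb]
  rw [← integral_finsetSum _ fun x _ => hψ.integrable_prod_norm_sq x]
  simp only [sum_prod_filter_eq g (hψ.sum_norm_sq _) hij]
  rfl

theorem one_sub_le_sum_outcomeProb_injective [IsProbabilityMeasure μ] (hψ : IsRandomState ψ)
    {α : Type*} [Fintype α] [Fintype β] [DecidableEq β] (g : α → ι → β) {δ : ℝ}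
    (hg : ∀ a, collisionProb (g a) μ ψ ≤ δ) :
    1 - Fintype.card α * (k ^ 2 * δ) ≤
      ∑ x : Fin k → ι with ∀ a, Function.Injective fun j => g a (x j), outcomeProb k μ ψ x := by
  classical
  let T : Finset (α × Fin k × Fin k) := Finset.univ ×ˢ Finset.univ.offDiag
  have hbad : ∑ x : Fin k → ι with ¬∀ a, Function.Injective fun j => g a (x j),
      outcomeProb k μ ψ x ≤ Fintype.card α * (k ^ 2 * δ) := calc
    _ = ∑ x with ∃ p ∈ T, g p.1 (x p.2.1) = g p.1 (x p.2.2), outcomeProb k μ ψ x := by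
      refine Finset.sum_congr (Finset.filter_congr fun x _ => ?_) fun _ _ => rfl
      simp [T, Function.Injective, and_comm]
    _ ≤ ∑ p ∈ T, ∑ x with g p.1 (x p.2.1) = g p.1 (x p.2.2), outcomeProb k μ ψ x :=
      sum_filter_exists_le outcomeProb_nonneg T _
    _ = ∑ p ∈ T, collisionProb (g p.1) μ ψ := by
      refine Finset.sum_congr rfl fun p hp => hψ.sum_outcomeProb_filter_eq (g p.1) ?_
      simpa [T] using hp
    _ = ∑ a, ((k * k - k : ℕ) : ℝ) * collisionProb (g a) μ ψ := by
      simp [T, Finset.sum_product, Finset.offDiag_card]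
    _ ≤ ∑ _a : α, (k ^ 2 * δ : ℝ) := by
      refine Finset.sum_le_sum fun a _ => ?_
      have hk : ((k * k - k : ℕ) : ℝ) ≤ k ^ 2 := by
        rw [sq]
        exact_mod_cast Nat.sub_le _ _
      exact mul_le_mul hk (hg a) (collisionProb_nonneg _) (sq_nonneg _)
    _ = Fintype.card α * (k ^ 2 * δ) := by
      rw [Finset.sum_const, Finset.card_univ, nsmul_eq_mul]
  have htotal := Finset.sum_filter_add_sum_filter_not Finset.univ
    (fun x : Fin k → ι => ∀ a, Function.Injective fun j => g a (x j)) (outcomeProb k μ ψ)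
  rw [hψ.sum_outcomeProb] at htotal
  linarith

end IsRandomState

end

end RandomState

section Haar

variable {ι : Type*} [Fintype ι] [DecidableEq ι] {k : ℕ}

instance : IsProbabilityMeasure (haarUnitary ι) :=
  ⟨Measure.haarMeasure_self⟩

instance : (haarUnitary ι).IsMulLeftInvariant :=
  inferInstanceAs (Measure.haarMeasure _).IsMulLeftInvariant

/-- The state `U φ`, whose `k`-th moment for Haar-random `U` is the Haar twirl. -/
noncomputable def applyUnitary (φ : EuclideanSpace ℂ ι) (U : Matrix.unitaryGroup ι ℂ) :
    EuclideanSpace ℂ ι :=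
  WithLp.toLp 2 ((U : Matrix ι ι ℂ).mulVec φ.ofLp)

theorem haarTwirl_eq_stateMoment (φ : EuclideanSpace ℂ ι) :
    haarTwirl k φ = stateMoment k (haarUnitary ι) (applyUnitary φ) := rfl

theorem applyUnitary_apply (φ : EuclideanSpace ℂ ι) (U : Matrix.unitaryGroup ι ℂ) (i : ι) :
    applyUnitary φ U i = ∑ j, (U : Matrix ι ι ℂ) i j * φ j := rfl

theorem applyUnitary_mul (φ : EuclideanSpace ℂ ι) (V U : Matrix.unitaryGroup ι ℂ) :
    applyUnitary φ (V * U) = applyUnitary (applyUnitary φ U) V := by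
  simp [applyUnitary, Matrix.mulVec_mulVec]

@[fun_prop]
theorem continuous_applyUnitary (φ : EuclideanSpace ℂ ι) : Continuous (applyUnitary φ) :=
  (PiLp.continuous_toLp 2 _).comp (continuous_subtype_val.matrix_mulVec continuous_const)

open Matrix in
theorem norm_applyUnitary (φ : EuclideanSpace ℂ ι) (U : Matrix.unitaryGroup ι ℂ) :
    ‖applyUnitary φ U‖ = ‖φ‖ := by
  have hinner : inner ℂ (applyUnitary φ U) (applyUnitary φ U) = inner ℂ φ φ := by
    rw [EuclideanSpace.inner_eq_star_dotProduct, EuclideanSpace.inner_eq_star_dotProduct,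
      dotProduct_comm, applyUnitary, star_mulVec, ← dotProduct_mulVec, mulVec_mulVec,
      ← star_eq_conjTranspose, Unitary.star_mul_self_of_mem U.2, one_mulVec, dotProduct_comm]
  rw [norm_eq_sqrt_re_inner (𝕜 := ℂ), hinner, ← norm_eq_sqrt_re_inner]

theorem isRandomState_applyUnitary {φ : EuclideanSpace ℂ ι} (hφ : ‖φ‖ = 1) :
    IsRandomState (applyUnitary φ) where
  measurable := (continuous_applyUnitary φ).measurable
  norm_eq_one U := (norm_applyUnitary φ U).trans hφ

theorem integrable_haarUnitary {E : Type*} [NormedAddCommGroup E]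
    {F : Matrix.unitaryGroup ι ℂ → E} (hF : Continuous F) : Integrable F (haarUnitary ι) :=
  hF.integrable_of_hasCompactSupport (HasCompactSupport.of_compactSpace F)

theorem integral_comp_applyUnitary {E : Type*} [NormedAddCommGroup E] [NormedSpace ℝ E]
    (φ : EuclideanSpace ℂ ι) (F : EuclideanSpace ℂ ι → E) (V : Matrix.unitaryGroup ι ℂ) :
    ∫ U, F (applyUnitary (applyUnitary φ U) V) ∂haarUnitary ι =
      ∫ U, F (applyUnitary φ U) ∂haarUnitary ι := by
  simp only [← applyUnitary_mul]
  exact integral_mul_left_eq_self (fun U => F (applyUnitary φ U)) V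

theorem exists_applyUnitary_apply_eq_inner {v : EuclideanSpace ℂ ι} (hv : ‖v‖ = 1) (i : ι) :
    ∃ V : Matrix.unitaryGroup ι ℂ, ∀ φ, applyUnitary φ V i = inner ℂ v φ := by
  obtain ⟨b, hb⟩ := Orthonormal.exists_orthonormalBasis_extension_of_card_eq (𝕜 := ℂ)
    (finrank_euclideanSpace (𝕜 := ℂ) (ι := ι)) (v := fun _ => v) (s := {i})
    ⟨fun _ => hv, fun a c hac => absurd (Subsingleton.elim a c) hac⟩
  let W : Matrix.unitaryGroup ι ℂ :=
    ⟨_, (EuclideanSpace.basisFun ι ℂ).toMatrix_orthonormalBasis_mem_unitary b⟩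
  refine ⟨star W, fun φ => ?_⟩
  simp [applyUnitary_apply, W, Module.Basis.toMatrix_apply, PiLp.inner_apply, hb i rfl, mul_comm]

theorem integral_norm_inner_pow (φ v : EuclideanSpace ℂ ι) (i : ι) {t : ℕ} (ht : t ≠ 0) :
    ∫ U, ‖inner ℂ v (applyUnitary φ U)‖ ^ t ∂haarUnitary ι =
      ‖v‖ ^ t * ∫ U, ‖applyUnitary φ U i‖ ^ t ∂haarUnitary ι := by
  obtain rfl | hv := eq_or_ne v 0
  · simp [ht]
  obtain ⟨V, hV⟩ := exists_applyUnitary_apply_eq_inner (norm_smul_inv_norm (𝕜 := ℂ) hv) i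
  have hinner : ∀ ψ, ‖v‖ ^ t * ‖applyUnitary ψ V i‖ ^ t = ‖inner ℂ v ψ‖ ^ t := fun ψ => by
    rw [hV, inner_smul_left, norm_mul, ← mul_pow]
    simp [hv]
  rw [← integral_comp_applyUnitary φ (fun ψ => ‖ψ i‖ ^ t) V, ← integral_const_mul]
  simp only [hinner]

theorem integral_norm_apply_pow (φ : EuclideanSpace ℂ ι) (i j : ι) {t : ℕ} (ht : t ≠ 0) :
    ∫ U, ‖applyUnitary φ U i‖ ^ t ∂haarUnitary ι =
      ∫ U, ‖applyUnitary φ U j‖ ^ t ∂haarUnitary ι := by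
  simpa [EuclideanSpace.inner_single_left] using
    integral_norm_inner_pow φ (EuclideanSpace.single i 1) j ht

theorem sum_norm_add_mul_pow_four (a b : ℂ) :
    ∑ t : Fin 4, ‖a + ![1, -1, Complex.I, -Complex.I] t * b‖ ^ 4 =
      4 * ‖a‖ ^ 4 + 4 * ‖b‖ ^ 4 + 16 * (‖a‖ ^ 2 * ‖b‖ ^ 2) := by
  have hpow : ∀ z : ℂ, ‖z‖ ^ 4 = (‖z‖ ^ 2) ^ 2 := fun z => by ring
  simp only [Fin.sum_univ_four, hpow, Complex.sq_norm, Complex.normSq_apply, Matrix.cons_val,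
    one_mul, neg_mul, Complex.add_re, Complex.add_im, Complex.neg_re, Complex.neg_im,
    Complex.mul_re, Complex.mul_im, Complex.I_re, Complex.I_im, Complex.one_re,
    Complex.one_im]
  ring

theorem integral_norm_add_mul_pow_four (φ : EuclideanSpace ℂ ι) {i j : ι} (hij : i ≠ j) {c : ℂ}
    (hc : ‖c‖ = 1) :
    ∫ U, ‖applyUnitary φ U i + c * applyUnitary φ U j‖ ^ 4 ∂haarUnitary ι =
      4 * ∫ U, ‖applyUnitary φ U i‖ ^ 4 ∂haarUnitary ι := by
  let v : EuclideanSpace ℂ ι := EuclideanSpace.single i 1 + EuclideanSpace.single j (star c)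
  have hv : ‖v‖ ^ 2 = 2 := by
    have horth : inner ℂ (EuclideanSpace.single i (1 : ℂ)) (EuclideanSpace.single j (star c)) = 0 :=
      by simp [EuclideanSpace.inner_single_left, hij]
    rw [sq, norm_add_sq_eq_norm_sq_add_norm_sq_of_inner_eq_zero _ _ horth,
      PiLp.norm_single, PiLp.norm_single, norm_one, norm_star, hc]
    norm_num
  have hinner : ∀ ψ : EuclideanSpace ℂ ι, inner ℂ v ψ = ψ i + c * ψ j := fun ψ => by
    simp [v, EuclideanSpace.inner_single_left]
  have h := integral_norm_inner_pow φ v i four_ne_zero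
  simp only [hinner, show ‖v‖ ^ 4 = (‖v‖ ^ 2) ^ 2 by ring, hv] at h
  linarith

-- Averaging `|a + c b| ^ 4` over the phases `c = ±1, ±i` removes every cross term except
-- `|a| ^ 2 |b| ^ 2`, which is thus expressed through pure fourth moments.
theorem integral_norm_sq_mul_norm_sq (φ : EuclideanSpace ℂ ι) {i j : ι} (hij : i ≠ j) :
    2 * ∫ U, ‖applyUnitary φ U i‖ ^ 2 * ‖applyUnitary φ U j‖ ^ 2 ∂haarUnitary ι =
      ∫ U, ‖applyUnitary φ U i‖ ^ 4 ∂haarUnitary ι := by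
  have hphase : ∀ t, ‖(![1, -1, Complex.I, -Complex.I] : Fin 4 → ℂ) t‖ = 1 := fun t => by
    fin_cases t <;> simp
  have h : ∫ U, ∑ t : Fin 4, ‖applyUnitary φ U i +
      ![1, -1, Complex.I, -Complex.I] t * applyUnitary φ U j‖ ^ 4 ∂haarUnitary ι =
      16 * ∫ U, ‖applyUnitary φ U i‖ ^ 4 ∂haarUnitary ι := by
    rw [integral_finsetSum _ fun t _ => integrable_haarUnitary (by fun_prop),
      Finset.sum_congr rfl fun t _ => integral_norm_add_mul_pow_four φ hij (hphase t),
      Finset.sum_const, Finset.card_fin, nsmul_eq_mul]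
    push_cast
    ring
  simp only [sum_norm_add_mul_pow_four] at h
  rw [integral_add (integrable_haarUnitary (by fun_prop)) (integrable_haarUnitary (by fun_prop)),
    integral_add (integrable_haarUnitary (by fun_prop)) (integrable_haarUnitary (by fun_prop)),
    integral_const_mul, integral_const_mul, integral_const_mul,
    integral_norm_apply_pow φ j i four_ne_zero] at h
  linarith

theorem collisionProb_id_applyUnitary {φ : EuclideanSpace ℂ ι} (hφ : ‖φ‖ = 1) :
    collisionProb id (haarUnitary ι) (applyUnitary φ) = 2 / (Fintype.card ι + 1) := by
  let M : ι → ℝ := fun i => ∫ U, ‖applyUnitary φ U i‖ ^ 4 ∂haarUnitary ι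
  have hsum : collisionProb id (haarUnitary ι) (applyUnitary φ) = ∑ i, M i := by
    rw [← integral_finsetSum _ fun i _ => integrable_haarUnitary (by fun_prop)]
    simp [collisionProb, Finset.filter_eq', ← pow_mul]
  have hpair : ∀ i j, 2 * ∫ U, ‖applyUnitary φ U i‖ ^ 2 * ‖applyUnitary φ U j‖ ^ 2
      ∂haarUnitary ι = M i + if i = j then M i else 0 := fun i j => by
    split_ifs with h
    · simp [M, ← h, ← pow_add, two_mul]
    · rw [integral_norm_sq_mul_norm_sq φ h, add_zero]
  have hint : ∀ i j, Integrable (fun U => ‖applyUnitary φ U i‖ ^ 2 * ‖applyUnitary φ U j‖ ^ 2)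
      (haarUnitary ι) := fun i j => integrable_haarUnitary (by fun_prop)
  have htotal : ∫ U, ∑ i, ∑ j, ‖applyUnitary φ U i‖ ^ 2 * ‖applyUnitary φ U j‖ ^ 2
      ∂haarUnitary ι = 1 := by
    simp [← Finset.mul_sum, (isRandomState_applyUnitary hφ).sum_norm_sq]
  rw [integral_finsetSum _ fun i _ => integrable_finsetSum _ fun j _ => hint i j] at htotal
  simp only [integral_finsetSum _ fun j _ => hint _ j] at htotal
  have hdouble := congrArg (2 * ·) htotal
  simp only [Finset.mul_sum, hpair, Finset.sum_add_distrib, Finset.sum_ite_eq, Finset.mem_univ,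
    if_true, Finset.sum_const, Finset.card_univ, nsmul_eq_mul] at hdouble
  rw [← Finset.mul_sum] at hdouble
  rw [hsum, eq_div_iff (by positivity)]
  linarith

end Haar

section Tuples

variable {κ α : Type*} {x y : κ → α}

theorem exists_perm_eq_comp [Finite κ] (hx : Function.Injective x) (hxy : ∀ j, ∃ i, y i = x j) :
    ∃ σ : Equiv.Perm κ, y = x ∘ σ := by
  choose τ hτ using hxy
  have hτ_inj : Function.Injective τ := fun i j h => hx (by rw [← hτ, h, hτ])
  let σ := Equiv.ofBijective τ (Finite.injective_iff_bijective.mp hτ_inj)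
  refine ⟨σ.symm, funext fun i => ?_⟩
  rw [Function.comp_apply, ← hτ]
  exact congrArg y (σ.apply_symm_apply i).symm

theorem exists_injective_eq_comp [Fintype κ] [Fintype α] {t : ℕ} (hκ : Fintype.card κ ≤ t)
    (hα : t ≤ Fintype.card α) (w : κ → α) :
    ∃ x : Fin t → α, Function.Injective x ∧ ∃ e, w = x ∘ e := by
  classical
  have himage : (Finset.univ.image w).card ≤ t := Finset.card_image_le.trans hκ
  obtain ⟨T, hwT, hT⟩ := Finset.exists_superset_card_eq himage hα
  let e := T.equivFinOfCardEq hT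
  have hw : ∀ l, w l ∈ T := fun l => hwT (Finset.mem_image_of_mem w (Finset.mem_univ l))
  exact ⟨fun i => e.symm i, Subtype.val_injective.comp e.symm.injective, fun l => e ⟨w l, hw l⟩,
    funext fun l => by simp⟩

theorem odd_card_filter_sumElim_eq [Fintype κ] [DecidableEq α] (hx : Function.Injective x) {j : κ}
    (hj : ∀ i, y i ≠ x j) : Odd (Finset.univ.filter (Sum.elim x y · = x j)).card := by
  classical
  have hfilter : Finset.univ.filter (Sum.elim x y · = x j) = {Sum.inl j} := by
    ext (i | i) <;> simp [hx.eq_iff, hj]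
  rw [hfilter, Finset.card_singleton]
  exact odd_one

end Tuples

section HaarTwirl

variable {ι : Type*} [Fintype ι] [DecidableEq ι] {k : ℕ}

theorem exists_applyUnitary_apply_eq_signFlip (z : ι) : ∃ V : Matrix.unitaryGroup ι ℂ,
    ∀ φ i, applyUnitary φ V i = (if i = z then -1 else 1) * φ i := by
  let d : ι → ℂ := fun i => if i = z then -1 else 1
  have hd : (fun i => star d i * d i) = fun _ => 1 := by
    ext i
    by_cases hi : i = z <;> simp [d, hi]
  have hV : Matrix.diagonal d ∈ Matrix.unitaryGroup ι ℂ := by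
    rw [Matrix.mem_unitaryGroup_iff', Matrix.star_eq_conjTranspose, Matrix.diagonal_conjTranspose,
      Matrix.diagonal_mul_diagonal', hd, Matrix.diagonal_one]
  exact ⟨⟨_, hV⟩, fun φ i => Matrix.mulVec_diagonal _ _ _⟩

theorem exists_applyUnitary_apply_eq_comp (π : Equiv.Perm ι) : ∃ V : Matrix.unitaryGroup ι ℂ,
    ∀ φ i, applyUnitary φ V i = φ (π i) := by
  have hV : π.permMatrix ℂ ∈ Matrix.unitaryGroup ι ℂ := by
    rw [Matrix.mem_unitaryGroup_iff, Matrix.star_eq_conjTranspose, Matrix.conjTranspose_permMatrix,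
      ← Matrix.permMatrix_mul, inv_mul_cancel, Matrix.permMatrix_one]
  exact ⟨⟨_, hV⟩, fun φ => congrFun (Matrix.permMatrix_mulVec π)⟩

theorem haarTwirl_apply_eq_zero (φ : EuclideanSpace ℂ ι) {x y : Fin k → ι} {z : ι}
    (hz : Odd (Finset.univ.filter (Sum.elim x y · = z)).card) : haarTwirl k φ x y = 0 := by
  obtain ⟨V, hV⟩ := exists_applyUnitary_apply_eq_signFlip z
  have hsign : (∏ j, if x j = z then -1 else (1 : ℂ)) * ∏ j, (if y j = z then -1 else 1) = -1 := by
    have hprod : ∏ l, (if Sum.elim x y l = z then -1 else (1 : ℂ)) = -1 := by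
      rw [← Finset.prod_filter, Finset.prod_const, hz.neg_one_pow]
    rwa [Fintype.prod_sum_type] at hprod
  have hflip : ∀ ψ : EuclideanSpace ℂ ι, tensorCopies k (applyUnitary ψ V) x *
      star (tensorCopies k (applyUnitary ψ V) y) =
      -(tensorCopies k ψ x * star (tensorCopies k ψ y)) := fun ψ => by
    simp only [tensorCopies, hV, Finset.prod_mul_distrib, star_mul', star_prod, apply_ite star,
      star_neg, star_one]
    linear_combination (∏ j, ψ (x j)) * (∏ j, star (ψ (y j))) * hsign
  have h := integral_comp_applyUnitary φ
    (fun ψ => tensorCopies k ψ x * star (tensorCopies k ψ y)) V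
  simp only [hflip, integral_neg] at h
  exact self_eq_neg.mp h.symm

theorem outcomeProb_applyUnitary_eq (φ : EuclideanSpace ℂ ι) {x y : Fin k → ι}
    (hx : Function.Injective x) (hy : Function.Injective y) :
    outcomeProb k (haarUnitary ι) (applyUnitary φ) x =
      outcomeProb k (haarUnitary ι) (applyUnitary φ) y := by
  obtain ⟨π, hπ⟩ := Equiv.Perm.exists_extending_pair x y hx hy
  obtain ⟨V, hV⟩ := exists_applyUnitary_apply_eq_comp π
  have h := integral_comp_applyUnitary φ (fun ψ => ∏ j, ‖ψ (x j)‖ ^ 2) V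
  simp only [hV, hπ] at h
  exact h.symm

theorem sum_outcomeProb_injective_le (φ : EuclideanSpace ℂ ι) {x : Fin k → ι}
    (hx : Function.Injective x) :
    ∑ y : Fin k → ι with Function.Injective y, outcomeProb k (haarUnitary ι) (applyUnitary φ) y ≤
      Fintype.card ι ^ k * outcomeProb k (haarUnitary ι) (applyUnitary φ) x := by
  rw [Finset.sum_congr rfl fun y hy =>
    outcomeProb_applyUnitary_eq φ (Finset.mem_filter.mp hy).2 hx, Finset.sum_const, nsmul_eq_mul]
  have hcard : (Finset.univ.filter fun y : Fin k → ι => Function.Injective y).card ≤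
      Fintype.card ι ^ k := by
    simpa using Finset.card_filter_le (Finset.univ : Finset (Fin k → ι)) _
  gcongr
  · exact outcomeProb_nonneg x
  · exact_mod_cast hcard

end HaarTwirl

section FlatState

variable {ι Ω : Type*} [Fintype ι] [MeasurableSpace Ω] {k : ℕ} {μ : Measure Ω}
  {ψ : Ω → EuclideanSpace ℂ ι}

theorem exists_le_forall_injective_outcomeProb_eq [DecidableEq ι] (φ : EuclideanSpace ℂ ι) :
    ∃ r, ∑ x : Fin k → ι with Function.Injective x,
        outcomeProb k (haarUnitary ι) (applyUnitary φ) x ≤ r ∧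
      ∀ x : Fin k → ι, Function.Injective x →
        Fintype.card ι ^ k * outcomeProb k (haarUnitary ι) (applyUnitary φ) x = r := by
  by_cases h : ∃ x₀ : Fin k → ι, Function.Injective x₀
  · obtain ⟨x₀, hx₀⟩ := h
    exact ⟨_, sum_outcomeProb_injective_le φ hx₀,
      fun x hx => by rw [outcomeProb_applyUnitary_eq φ hx hx₀]⟩
  · exact ⟨_, le_rfl, fun x hx => absurd ⟨x, hx⟩ h⟩

theorem one_sub_le_sum_outcomeProb_applyUnitary_injective [DecidableEq ι] {φ : EuclideanSpace ℂ ι}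
    (hφ : ‖φ‖ = 1) :
    1 - k ^ 2 * (2 / (Fintype.card ι + 1)) ≤ ∑ x : Fin k → ι with Function.Injective x,
      outcomeProb k (haarUnitary ι) (applyUnitary φ) x := by
  simpa only [Fintype.card_unit, Nat.cast_one, one_mul, forall_const, id_eq] using
    (isRandomState_applyUnitary hφ).one_sub_le_sum_outcomeProb_injective (k := k)
      (fun _ : Unit => id) fun _ => (collisionProb_id_applyUnitary hφ).le

theorem traceNorm_stateMoment_sub_haarTwirl_le [DecidableEq ι] [IsProbabilityMeasure μ]
    (hψ : IsRandomState ψ) (hflat : ∀ ω z, ‖ψ ω z‖ ^ 2 = 1 / Fintype.card ι)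
    {φ : EuclideanSpace ℂ ι} (hφ : ‖φ‖ = 1) {G : Finset (Fin k → ι)}
    (hG_inj : ∀ x ∈ G, Function.Injective x) (hG_perm : ∀ x ∈ G, ∀ σ : Equiv.Perm _, x ∘ σ ∈ G)
    (hG_zero : ∀ x ∈ G, ∀ y, (∀ σ : Equiv.Perm _, y ≠ x ∘ σ) → stateMoment k μ ψ x y = 0) :
    traceNorm (stateMoment k μ ψ - haarTwirl k φ) ≤
      2 * (k ^ 2 * (2 / (Fintype.card ι + 1)) + (1 - ∑ x ∈ G, outcomeProb k μ ψ x)) := by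
  have hU := isRandomState_applyUnitary hφ
  have : Nonempty ι := not_isEmpty_iff.mp fun _ => by simp [EuclideanSpace.norm_eq] at hφ
  obtain ⟨r, hsr, hr⟩ := exists_le_forall_injective_outcomeProb_eq (k := k) φ
  have hHA : ∀ x ∈ G, ∀ y, haarTwirl k φ x y = r * stateMoment k μ ψ x y := fun x hx y => by
    by_cases hy : ∃ σ : Equiv.Perm _, y = x ∘ σ
    · obtain ⟨σ, rfl⟩ := hy
      rw [haarTwirl_eq_stateMoment, stateMoment_apply_comp_perm, stateMoment_apply_comp_perm,
        stateMoment_apply_self, stateMoment_apply_self, outcomeProb_of_norm_sq_eq hflat,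
        ← hr x (hG_inj x hx), ← Complex.ofReal_mul, mul_right_comm, ← mul_pow,
        mul_one_div_cancel (Nat.cast_ne_zero.mpr Fintype.card_ne_zero), one_pow, one_mul]
    · obtain ⟨j, hj⟩ : ∃ j, ∀ i, y i ≠ x j := by
        by_contra! h
        exact hy (exists_perm_eq_comp (hG_inj x hx) h)
      rw [hG_zero x hx y (not_exists.mp hy), mul_zero,
        haarTwirl_apply_eq_zero φ (odd_card_filter_sumElim_eq (hG_inj x hx) hj)]
  have hAG : ∀ x ∈ G, ∀ y ∉ G, stateMoment k μ ψ x y = 0 := fun x hx y hy =>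
    hG_zero x hx y fun σ h => hy (h ▸ hG_perm x hx σ)
  have hblock := traceNorm_sub_le_of_block hψ.posSemidef_stateMoment hU.posSemidef_stateMoment
    hψ.trace_stateMoment hU.trace_stateMoment (hU.sum_outcomeProb_le_one _) hsr hHA hAG
  simp only [stateMoment_apply_self, Complex.ofReal_re] at hblock
  have hU_inj := one_sub_le_sum_outcomeProb_applyUnitary_injective (k := k) hφ
  have hcross := mul_nonneg (sub_nonneg.mpr (hU.sum_outcomeProb_le_one (μ := haarUnitary ι)
    (Finset.univ.filter fun x : Fin k → ι => Function.Injective x)))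
    (sub_nonneg.mpr (hψ.sum_outcomeProb_le_one (μ := μ) G))
  refine hblock.trans ?_
  linarith

end FlatState

section TWiseIndependent

variable {Ω α : Type*} [MeasurableSpace Ω] {t : ℕ} {μ : Measure Ω} [IsFiniteMeasure μ]
  {f : Ω → α → Bool}

theorem IsTWiseIndependent.integral_comp {E : Type*} [NormedAddCommGroup E] [NormedSpace ℝ E]
    [CompleteSpace E] (hf : IsTWiseIndependent t μ f) (hf_meas : Measurable f) {x : Fin t → α}
    (hx : Function.Injective x) (F : (Fin t → Bool) → E) :
    ∫ ω, F (fun i => f ω (x i)) ∂μ = (1 / 2 : ℝ) ^ t • ∑ y, F y := by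
  have hX : Measurable fun ω i => f ω (x i) := by fun_prop
  have hlaw : ∀ y, (μ.map fun ω i => f ω (x i)).real {y} = (1 / 2 : ℝ) ^ t := fun y => by
    rw [map_measureReal_apply hX (measurableSet_singleton y), ← hf x hx y]
    simp only [Set.preimage, Set.mem_singleton_iff, funext_iff]
  rw [← integral_map (φ := fun ω i => f ω (x i)) (f := F) hX.aemeasurable
    StronglyMeasurable.of_discrete.aestronglyMeasurable, integral_fintype .of_finite]
  simp only [hlaw, Finset.smul_sum]

theorem IsTWiseIndependent.integral_prod_sign_eq_zero [Fintype α] [DecidableEq α] {κ : Type*}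
    [Fintype κ] (hf : IsTWiseIndependent t μ f) (hf_meas : Measurable f)
    (hκ : Fintype.card κ ≤ t) (hα : t ≤ Fintype.card α) {w : κ → α} {z : α}
    (hz : Odd (Finset.univ.filter (w · = z)).card) :
    ∫ ω, ∏ l, (-1 : ℂ) ^ (f ω (w l)).toNat ∂μ = 0 := by
  obtain ⟨x, hx, e, rfl⟩ := exists_injective_eq_comp hκ hα w
  let c : Fin t → ℕ := fun i => (Finset.univ.filter (e · = i)).card
  have hfiber : ∀ y : Fin t → Bool,
      ∏ l, (-1 : ℂ) ^ (y (e l)).toNat = ∏ i, (-1) ^ ((y i).toNat * c i) := fun y => by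
    rw [← Finset.prod_fiberwise _ e]
    refine Finset.prod_congr rfl fun i _ => ?_
    rw [Finset.prod_congr rfl fun l hl => by rw [(Finset.mem_filter.mp hl).2], Finset.prod_const,
      pow_mul]
  obtain ⟨i, hi⟩ : ∃ i, Odd (c i) := by
    obtain ⟨l, hl⟩ := Finset.card_pos.mp hz.pos
    refine ⟨e l, ?_⟩
    rw [← (Finset.mem_filter.mp hl).2] at hz
    simpa only [Function.comp_apply, hx.eq_iff] using hz
  have hsum : ∑ y : Fin t → Bool, ∏ i, (-1 : ℂ) ^ ((y i).toNat * c i) = 0 := by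
    rw [← Fintype.prod_sum fun i (b : Bool) => (-1 : ℂ) ^ (b.toNat * c i)]
    exact Finset.prod_eq_zero (Finset.mem_univ i) (by simp [hi.neg_one_pow])
  have hcomp := hf.integral_comp hf_meas hx fun y => ∏ l, (-1 : ℂ) ^ (y (e l)).toNat
  simpa only [Function.comp_apply, hfiber, hsum, smul_zero] using hcomp

end TWiseIndependent

section Graph

theorem exists_perm_eq_comp_of_preconnected {V S κ : Type*} [Finite κ] [Nontrivial V]
    {G : SimpleGraph V} (hG : G.Preconnected) {x y : κ → V → S}
    (hx : ∀ a, Function.Injective fun j => x j a)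
    (hxy : ∀ a c, G.Adj a c → ∀ j, ∃ i, y i a = x j a ∧ y i c = x j c) :
    ∃ σ : Equiv.Perm κ, y = x ∘ σ := by
  have hedge : ∀ a c, G.Adj a c → ∃ σ : Equiv.Perm κ, ∀ i, y i a = x (σ i) a ∧ y i c = x (σ i) c :=
    fun a c hac => by
    have hpair : Function.Injective fun j => (x j a, x j c) := fun i j h =>
      hx a (congrArg Prod.fst h)
    obtain ⟨σ, hσ⟩ := exists_perm_eq_comp (y := fun i => (y i a, y i c)) hpair fun j =>
      (hxy a c hac j).imp fun i hi => Prod.ext hi.1 hi.2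
    exact ⟨σ, fun i => Prod.ext_iff.mp (congrFun hσ i)⟩
  have hvertex : ∀ a, ∃ σ : Equiv.Perm κ, ∀ i, y i a = x (σ i) a := fun a => by
    obtain ⟨c, hac⟩ := hG.exists_adj_of_nontrivial a
    exact (hedge a c hac).imp fun σ hσ i => (hσ i).1
  choose π hπ using hvertex
  have hadj : ∀ a c, G.Adj a c → π a = π c := fun a c hac => by
    obtain ⟨σ, hσ⟩ := hedge a c hac
    ext i
    rw [hx a ((hπ a i).symm.trans (hσ i).1), hx c ((hπ c i).symm.trans (hσ i).2)]
  have hconst : ∀ a c, π a = π c := fun a c => by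
    obtain ⟨p⟩ := hG a c
    induction p with
    | nil => rfl
    | cons h _ ih => exact (hadj _ _ h).trans ih
  obtain ⟨a₀⟩ : Nonempty V := inferInstance
  exact ⟨π a₀, funext fun i => funext fun a => by rw [hπ a i, hconst a a₀, Function.comp_apply]⟩

end Graph

section Patches

variable {n m ξ k : ℕ} (hn : n = m * ξ) {b : Boundary}

/-- A bit string corresponds to the list of its restrictions to the patches. -/
def patchEquiv : Bits n ≃ (Fin m → Bits ξ) :=
  (Equiv.arrowCongr (finProdFinEquiv.trans (finCongr hn.symm)).symm (Equiv.refl Bool)).trans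
    (Equiv.curry _ _ _)

theorem patchEquiv_apply (x : Bits n) : patchEquiv hn x = patchBits hn x := rfl

theorem card_filter_patchBits_eq (a : Fin m) (v : Bits ξ) :
    (Finset.univ.filter fun x : Bits n => patchBits hn x a = v).card * 2 ^ ξ = 2 ^ n := by
  have hcard : (Finset.univ.filter fun x : Bits n => patchBits hn x a = v).card =
      (Finset.univ.filter fun u : Fin m → Bits ξ => u a = v).card :=
    Finset.card_equiv (patchEquiv hn) (by simp [patchEquiv_apply])
  have hpi := Fintype.card_filter_piFinset_const_eq_of_mem Finset.univ a (Finset.mem_univ v)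
  rw [Fintype.piFinset_univ] at hpi
  rw [hcard, hpi, Finset.card_univ, Fintype.card_pi_const, Fintype.card_bool, Fintype.card_fin,
    pow_sub_one_mul a.pos.ne', ← pow_mul, mul_comm, hn]

theorem blockBits_eq_iff {x y : Bits n} (p : Block b m) :
    blockBits hn x p = blockBits hn y p ↔
      patchBits hn x p.1.1 = patchBits hn y p.1.1 ∧ patchBits hn x p.1.2 = patchBits hn y p.1.2 :=
  (Fin.appendEquiv ξ ξ).injective.eq_iff (a := (patchBits hn x p.1.1, patchBits hn x p.1.2))
    (b := (patchBits hn y p.1.1, patchBits hn y p.1.2)) |>.trans Prod.ext_iff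

/-- The bit strings of `x` differ pairwise on each patch. -/
def PatchwiseInjective (x : Fin k → Bits n) : Prop :=
  ∀ a, Function.Injective fun j => patchBits hn (x j) a

variable {hn} {x y : Fin k → Bits n}

theorem PatchwiseInjective.injective_blockBits (hx : PatchwiseInjective hn x) (p : Block b m) :
    Function.Injective fun j => blockBits hn (x j) p := fun _ _ h =>
  hx p.1.1 ((blockBits_eq_iff hn p).mp h).1

theorem PatchwiseInjective.injective (hx : PatchwiseInjective hn x) (hm : m ≠ 0) :
    Function.Injective x :=
  (hx ⟨0, Nat.pos_of_ne_zero hm⟩).of_comp (f := fun z => patchBits hn z _)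

theorem PatchwiseInjective.comp_perm (hx : PatchwiseInjective hn x) (σ : Equiv.Perm (Fin k)) :
    PatchwiseInjective hn (x ∘ σ) := fun a => (hx a).comp σ.injective

theorem PatchwiseInjective.exists_perm_eq_comp (hx : PatchwiseInjective hn x) (hm : 2 ≤ m)
    (hxy : ∀ (p : Block b m) j, ∃ i, blockBits hn (y i) p = blockBits hn (x j) p) :
    ∃ σ : Equiv.Perm (Fin k), y = x ∘ σ := by
  have : Nontrivial (Fin m) := Fin.nontrivial_iff_two_le.mpr hm
  simp only [blockBits_eq_iff] at hxy
  obtain ⟨σ, hσ⟩ := exists_perm_eq_comp_of_preconnected (SimpleGraph.pathGraph_preconnected m)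
    (x := fun j => patchBits hn (x j)) (y := fun j => patchBits hn (y j)) hx fun a c hac j => by
      rcases SimpleGraph.pathGraph_adj.mp hac with h | h
      · exact hxy ⟨(a, c), .inl h⟩ j
      · exact (hxy ⟨(c, a), .inl h⟩ j).imp fun i => And.symm
  exact ⟨σ, funext fun i => (patchEquiv hn).injective (congrFun hσ i)⟩

end Patches

section BlockedPhaseState

variable {n m ξ k : ℕ} (hn : n = m * ξ) {b : Boundary}

theorem norm_sq_blockedPhaseState_apply (g : Block b m → Bits (ξ + ξ) → Bool) (z : Bits n) :
    ‖blockedPhaseState hn b g z‖ ^ 2 = 1 / 2 ^ n := by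
  simp [blockedPhaseState]

theorem star_blockedPhaseState_apply (g : Block b m → Bits (ξ + ξ) → Bool) (z : Bits n) :
    star (blockedPhaseState hn b g z) = blockedPhaseState hn b g z := by
  simp [blockedPhaseState]

theorem norm_blockedPhaseState (g : Block b m → Bits (ξ + ξ) → Bool) :
    ‖blockedPhaseState hn b g‖ = 1 := by
  rw [← sq_eq_sq₀ (norm_nonneg _) zero_le_one, EuclideanSpace.norm_sq_eq]
  simp [norm_sq_blockedPhaseState_apply]

theorem tensorCopies_mul_star_blockedPhaseState (g : Block b m → Bits (ξ + ξ) → Bool)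
    (x y : Fin k → Bits n) :
    tensorCopies k (blockedPhaseState hn b g) x * star (tensorCopies k (blockedPhaseState hn b g) y)
      = (1 / Real.sqrt (2 ^ n) : ℂ) ^ (k + k) * ∏ p, ∏ l, (-1) ^ (g p (Sum.elim
        (fun j => blockBits hn (x j) p) (fun j => blockBits hn (y j) p) l)).toNat := by
  simp only [tensorCopies, star_prod, star_blockedPhaseState_apply, Fintype.prod_sum_type,
    Sum.elim_inl, Sum.elim_inr, Finset.prod_mul_distrib, pow_add]
  rw [Finset.prod_comm, Finset.prod_comm (s := Finset.univ (α := Block b m))]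
  simp only [blockedPhaseState, Finset.prod_mul_distrib, ← Finset.prod_pow_eq_pow_sum,
    Finset.prod_const, Finset.card_univ, Fintype.card_fin]
  ring

variable {hn} {Ω : Type*} [MeasurableSpace Ω] {μ : Measure Ω}
  {f : Block b m → Ω → Bits (ξ + ξ) → Bool}

theorem isRandomState_blockedPhaseState (hf_meas : ∀ p, Measurable (f p)) :
    IsRandomState fun ω => blockedPhaseState hn b fun p => f p ω where
  measurable := (Measurable.of_discrete (f := blockedPhaseState hn b)).comp
    (measurable_pi_lambda _ hf_meas)
  norm_eq_one _ := norm_blockedPhaseState hn _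

theorem stateMoment_blockedPhaseState_eq_zero_of_forall_ne [IsProbabilityMeasure μ]
    (hf_meas : ∀ p, Measurable (f p)) (hf_indep : iIndepFun f μ)
    (hf_wise : ∀ p, IsTWiseIndependent (2 * k) μ (f p)) (hk : 2 * k ≤ 2 ^ (ξ + ξ))
    {x y : Fin k → Bits n} (p : Block b m) (hx : Function.Injective fun j => blockBits hn (x j) p)
    {j : Fin k} (hj : ∀ i, blockBits hn (y i) p ≠ blockBits hn (x j) p) :
    stateMoment k μ (fun ω => blockedPhaseState hn b fun p => f p ω) x y = 0 := by
  simp only [stateMoment_apply, tensorCopies_mul_star_blockedPhaseState]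
  rw [integral_const_mul, hf_indep.integral_fun_prod_comp
    (f := fun p g => ∏ l, (-1) ^ (g (Sum.elim
      (fun j => blockBits hn (x j) p) (fun j => blockBits hn (y j) p) l)).toNat)
    (fun p => (hf_meas p).aemeasurable) fun p => Measurable.of_discrete.aestronglyMeasurable,
    Finset.prod_eq_zero (Finset.mem_univ p), mul_zero]
  exact (hf_wise p).integral_prod_sign_eq_zero (hf_meas p) (by simp [two_mul]) (by simpa using hk)
    (odd_card_filter_sumElim_eq hx hj)

theorem collisionProb_patchBits_blockedPhaseState [IsProbabilityMeasure μ] (a : Fin m) :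
    collisionProb (patchBits hn · a) μ (fun ω => blockedPhaseState hn b fun p => f p ω) =
      1 / 2 ^ ξ := by
  have hfiber : ∀ v, ((Finset.univ.filter fun z : Bits n => patchBits hn z a = v).card : ℝ) *
      (1 / 2 ^ n) = 1 / 2 ^ ξ := fun v => by
    rw [mul_one_div, div_eq_div_iff (by positivity) (by positivity), one_mul]
    exact_mod_cast card_filter_patchBits_eq hn a v
  rw [collisionProb_of_norm_sq_eq fun _ => norm_sq_blockedPhaseState_apply hn _]
  simp only [hfiber]
  simp [sq]

end BlockedPhaseState

section Design

variable {n m ξ k : ℕ} {hn : n = m * ξ} {b : Boundary} {Ω : Type*} [MeasurableSpace Ω]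
  {μ : Measure Ω} [IsProbabilityMeasure μ] {f : Block b m → Ω → Bits (ξ + ξ) → Bool}

open Classical in
theorem one_sub_le_sum_outcomeProb_patchwiseInjective (hf_meas : ∀ p, Measurable (f p)) :
    1 - m * (k ^ 2 * (1 / 2 ^ ξ)) ≤ ∑ x : Fin k → Bits n with PatchwiseInjective hn x,
      outcomeProb k μ (fun ω => blockedPhaseState hn b fun p => f p ω) x := by
  have hψ := isRandomState_blockedPhaseState (hn := hn) hf_meas
  have hsum := hψ.one_sub_le_sum_outcomeProb_injective (k := k) (μ := μ)
    (fun a z => patchBits hn z a) fun a => (collisionProb_patchBits_blockedPhaseState a).le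
  rw [Fintype.card_fin] at hsum
  convert hsum
  exact Iff.rfl

theorem PatchwiseInjective.stateMoment_blockedPhaseState_eq_zero {x y : Fin k → Bits n}
    (hx : PatchwiseInjective hn x) (hm : 2 ≤ m) (hf_meas : ∀ p, Measurable (f p))
    (hf_indep : iIndepFun f μ) (hf_wise : ∀ p, IsTWiseIndependent (2 * k) μ (f p))
    (hk : 2 * k ≤ 2 ^ (ξ + ξ)) (hy : ∀ σ : Equiv.Perm (Fin k), y ≠ x ∘ σ) :
    stateMoment k μ (fun ω => blockedPhaseState hn b fun p => f p ω) x y = 0 := by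
  obtain ⟨p, j, hj⟩ :
      ∃ (p : Block b m) (j : Fin k), ∀ i, blockBits hn (y i) p ≠ blockBits hn (x j) p := by
    by_contra! h
    obtain ⟨σ, hσ⟩ := hx.exists_perm_eq_comp hm h
    exact hy σ hσ
  exact stateMoment_blockedPhaseState_eq_zero_of_forall_ne hf_meas hf_indep hf_wise hk p
    (hx.injective_blockBits p) hj

theorem one_le_mul_sq_mul_of_two_pow_lt (hm : 2 ≤ m) (hk : 2 ^ (ξ + ξ) < 2 * k) :
    (1 : ℝ) ≤ m * (k ^ 2 * (1 / 2 ^ ξ)) := by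
  have hξk : 2 ^ ξ ≤ m * k ^ 2 := calc
    2 ^ ξ ≤ 2 ^ (ξ + ξ) := Nat.pow_le_pow_right two_pos (Nat.le_add_left ξ ξ)
    _ ≤ 2 * k := hk.le
    _ ≤ m * k ^ 2 := Nat.mul_le_mul hm (Nat.le_self_pow two_ne_zero k)
  rw [mul_one_div, mul_div_assoc', one_le_div (by positivity)]
  exact_mod_cast hξk

theorem isApproxStateDesign_blockedPhaseState (hm : 2 ≤ m) (hf_meas : ∀ p, Measurable (f p))
    (hf_indep : iIndepFun f μ) (hf_wise : ∀ p, IsTWiseIndependent (2 * k) μ (f p)) :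
    IsApproxStateDesign k μ (fun ω => blockedPhaseState hn b fun p => f p ω)
      (2 * (k ^ 2 * (2 / (2 ^ n + 1)) + m * (k ^ 2 * (1 / 2 ^ ξ)))) := fun φ hφ => by
  classical
  have hψ := isRandomState_blockedPhaseState (hn := hn) hf_meas
  have hcard : (Fintype.card (Bits n) : ℝ) = 2 ^ n := by simp
  have hflat : ∀ ω z, ‖blockedPhaseState hn b (fun p => f p ω) z‖ ^ 2 =
      1 / Fintype.card (Bits n) := fun ω z => by rw [hcard, norm_sq_blockedPhaseState_apply]
  rw [← hcard]
  by_cases hk : 2 * k ≤ 2 ^ (ξ + ξ)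
  · let G : Finset (Fin k → Bits n) := Finset.univ.filter (PatchwiseInjective hn)
    have hG : ∀ {x}, x ∈ G ↔ PatchwiseInjective hn x := by simp [G]
    have hbound := traceNorm_stateMoment_sub_haarTwirl_le (G := G) (μ := μ) hψ hflat hφ
      (fun x hx => (hG.mp hx).injective (by lia)) (fun x hx σ => hG.mpr ((hG.mp hx).comp_perm σ))
      fun x hx y hy =>
        (hG.mp hx).stateMoment_blockedPhaseState_eq_zero hm hf_meas hf_indep hf_wise hk hy
    have hG_prob := one_sub_le_sum_outcomeProb_patchwiseInjective (k := k) (μ := μ) (hn := hn)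
      hf_meas
    linarith
  -- No `2 k` inputs are distinct, so the independence is vacuous, but the error is at least 2.
  · have hbound := traceNorm_stateMoment_sub_haarTwirl_le (k := k) (μ := μ) (G := ∅) hψ hflat hφ
      (by simp) (by simp) (by simp)
    rw [Finset.sum_empty] at hbound
    linarith [one_le_mul_sq_mul_of_two_pow_lt hm (not_le.mp hk)]

end Design

theorem mainTheorem2
    (n k ξ m : ℕ) (hξ : 1 ≤ ξ) (hm : 2 ≤ m) (hn : n = m * ξ) (b : Boundary)
    {Ω : Type*} [MeasurableSpace Ω] (μ : Measure Ω) [IsProbabilityMeasure μ]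
    (f : Block b m → Ω → Bits (ξ + ξ) → Bool)
    (hf_meas : ∀ p, Measurable (f p))
    (hf_indep : iIndepFun f μ)
    (hf_wise : ∀ p, IsTWiseIndependent (2 * k) μ (f p)) :
    IsApproxStateDesign k μ (fun ω => blockedPhaseState hn b fun p => f p ω)
        (3 * n * k ^ 2 / (2 ^ ξ * ξ) + 2 * k ^ 2 / 2 ^ n) ∧
      (3 * n * k ^ 2 / (2 ^ ξ * ξ) + 2 * k ^ 2 / 2 ^ n : ℝ) ≤
        4 * (n * k ^ 2 / (2 ^ ξ * ξ)) := by
  have hm' : (2 : ℝ) ≤ m := by exact_mod_cast hm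
  have hn_div : (n / ξ : ℝ) = m := by
    rw [hn, Nat.cast_mul, mul_div_cancel_right₀ _ (by positivity)]
  have hpatch : (n * k ^ 2 / (2 ^ ξ * ξ) : ℝ) = m * (k ^ 2 * (1 / 2 ^ ξ)) := by
    rw [← hn_div]
    ring
  have hglobal : (2 * k ^ 2 / 2 ^ n : ℝ) ≤ m * (k ^ 2 * (1 / 2 ^ ξ)) := by
    rw [mul_div_assoc, div_eq_mul_one_div]
    have hξn : ξ ≤ n := hn ▸ Nat.le_mul_of_pos_left ξ (by lia)
    gcongr
    exact one_le_two
  have hhaar : (k ^ 2 * (2 / (2 ^ n + 1)) : ℝ) ≤ 2 * k ^ 2 / 2 ^ n := by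
    rw [mul_div_assoc', mul_comm]
    gcongr
    linarith
  rw [mul_assoc 3, mul_div_assoc 3, hpatch]
  refine ⟨fun φ hφ => ?_, by linarith⟩
  have hdesign := isApproxStateDesign_blockedPhaseState (hn := hn) hm hf_meas hf_indep hf_wise φ hφ
  linarith
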